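/- Let $\mathscr X$ be a complex Banach space and $\omega>0$. Let $\mathcal X=\mathcal P_\omega(\mathbb R,\mathscr X)$ be the Banach space of continuous $\omega$-periodic functions $x:\mathbb R\to\mathscr X$ with the norm $\|x\|=\sup_t\|x(t)\|$, and let $v\in\mathcal F=\mathcal P_\omega(\mathbb R,\operatorname{End}\mathscr X)$, i.e. $v$ is a norm-continuous $\omega$-periodic function with values in the bounded linear operators on $\mathscr X$, $\|v\|_{\mathcal F}=\sup_t\|v(t)\|$. Let $A=-i\frac{d}{dt}$ in $\mathcal X$, with domain $D(A)=\{x\in\mathcal X: x \text{ is differentiable and } x'\in\mathcal X\}$, and let $V$ be the operator of multiplication by $v$, $(Vx)(t)=v(t)x(t)$. Assume that $$\frac{5.4\sqrt3\,\omega}{\pi}\,\|v\|_{\mathcal F}<1 .$$ Then there is an operator $C\in\operatorname{End}\mathscr X$ such that $A-V$ is similar to $A-V_0$, where $(V_0x)(t)=Cx(t)$ and both operators have domain $D(A)$. That is, there is a bounded linear operator $U:\mathcal X\to\mathcal X$ with bounded inverse such that $UD(A)=D(A)$ and $(A-V)Ux=U(A-V_0)x$ for all $x\in D(A)$. Thus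 the non-autonomous periodic problem reduces to an autonomous one: for $x,f\in\mathcal X$, the function $x$ is a (differentiable) solution of $-ix'(t)-v(t)x(t)=f(t)$, $t\in\mathbb R$, if and only if $u=U^{-1}x$ is a solution of $-iu'(t)-Cu(t)=h(t)$, $t\in\mathbb R$, with $h=U^{-1}f$. -/

import Mathlib

open scoped BoundedContinuousFunction

/-- The space `P_ω(ℝ, E)` of continuous `ω`-periodic functions `ℝ → E` with the supremum norm
(inherited from the bounded continuous functions). A continuous periodic function is bounded and
uniformly continuous, so for `ω > 0` these are exactly the vectors of `C_b(ℝ, E)` that are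
continuous under translations and fixed by the translation by `ω`. -/
def periodicSpace (ω : ℝ) (E : Type*) [NormedAddCommGroup E] [NormedSpace ℂ E] :
    Submodule ℂ (ℝ →ᵇ E) where
  carrier := {x | ∀ t, x (t + ω) = x t}
  add_mem' {x y} hx hy t := by
    change x (t + ω) + y (t + ω) = x t + y t
    rw [hx t, hy t]
  zero_mem' _ := rfl
  smul_mem' c x hx t := by
    change c • x (t + ω) = c • x t
    rw [hx t]

/-- The unperturbed operator `A = -i d/dt` in `P_ω(ℝ, E)`: its domain consists of the
`x ∈ P_ω(ℝ, E)` that are differentiable everywhere with derivative in `P_ω(ℝ, E)`, and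
`(A x)(t) = -i x'(t)`. -/
noncomputable def diffOp (ω : ℝ) (E : Type*) [NormedAddCommGroup E] [NormedSpace ℂ E] :
    periodicSpace ω E →ₗ.[ℂ] periodicSpace ω E where
  domain :=
    { carrier := {x | ∃ y : periodicSpace ω E, ∀ t, HasDerivAt x.1 (y.1 t) t}
      add_mem' := by
        rintro a b ⟨y, hy⟩ ⟨z, hz⟩
        exact ⟨y + z, fun t => (hy t).add (hz t)⟩
      zero_mem' := ⟨0, fun t => hasDerivAt_const t (0 : E)⟩
      smul_mem' := by
        rintro c a ⟨y, hy⟩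
        exact ⟨c • y, fun t => (hy t).const_smul c⟩ }
  toFun :=
    { toFun := fun x => (-Complex.I) • x.2.choose
      map_add' := by
        intro a b
        rw [← smul_add]
        congr 1
        refine Subtype.ext (BoundedContinuousFunction.ext fun t => ?_)
        exact ((a + b).2.choose_spec t).unique ((a.2.choose_spec t).add (b.2.choose_spec t))
      map_smul' := by
        intro c a
        rw [RingHom.id_apply, smul_comm c]
        congr 1
        refine Subtype.ext (BoundedContinuousFunction.ext fun t => ?_)
        exact ((c • a).2.choose_spec t).unique ((a.2.choose_spec t).const_smul c) }

/-- The value of `-i d/dt` does not depend on any choice: `(A x)(t) = -i x'(t)`. -/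
theorem diffOp_apply {ω : ℝ} {E : Type*} [NormedAddCommGroup E] [NormedSpace ℂ E]
    (x : (diffOp ω E).domain) (t : ℝ) :
    (diffOp ω E x).1 t = (-Complex.I) • deriv x.1.1 t := by
  change (-Complex.I) • (x.2.choose.1 t) = _
  rw [(x.2.choose_spec t).deriv]

/-- The equivalent description of `A = -i d/dt` as the generator of the translations:
`x ∈ D(A)` and `A x = y` if and only if `x(t) = x(s) + i ∫_s^t y(τ) dτ` for all `s ≤ t`. -/
theorem diffOp_eq_iff_integral {ω : ℝ} {E : Type*} [NormedAddCommGroup E] [NormedSpace ℂ E]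
    [CompleteSpace E] (x y : periodicSpace ω E) :
    (∃ h : x ∈ (diffOp ω E).domain, diffOp ω E ⟨x, h⟩ = y) ↔
      ∀ s t : ℝ, s ≤ t → x.1 t = x.1 s + Complex.I • ∫ τ in s..t, y.1 τ := by
  have hI : Complex.I * -Complex.I = 1 := by simp
  have hI' : -Complex.I * Complex.I = 1 := by simp
  constructor
  · rintro ⟨h, rfl⟩ s t -
    have hz := h.choose_spec
    have e : ∀ τ, (diffOp ω E ⟨x, h⟩).1 τ = (-Complex.I) • h.choose.1 τ := fun τ => rfl
    simp only [e]
    rw [intervalIntegral.integral_smul, smul_smul, hI, one_smul,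
      intervalIntegral.integral_eq_sub_of_hasDerivAt (fun τ _ => hz τ)
        (h.choose.1.continuous.intervalIntegrable _ _)]
    abel
  · intro H
    have hd : ∀ t, HasDerivAt x.1 ((Complex.I • y).1 t) t := by
      intro t
      have hy : Continuous (y.1 : ℝ → E) := y.1.continuous
      have h1 : HasDerivAt (fun u => ∫ τ in (t - 1)..u, y.1 τ) (y.1 t) t :=
        intervalIntegral.integral_hasDerivAt_right (hy.intervalIntegrable _ _)
          (hy.stronglyMeasurableAtFilter _ _) hy.continuousAt
      have h2 := (h1.const_smul Complex.I).const_add (x.1 (t - 1))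
      refine h2.congr_of_eventuallyEq ?_
      filter_upwards [lt_mem_nhds (show t - 1 < t by linarith)] with u hu
      exact H (t - 1) u hu.le
    refine ⟨⟨Complex.I • y, hd⟩, ?_⟩
    refine Subtype.ext (BoundedContinuousFunction.ext fun t => ?_)
    rw [diffOp_apply]
    change (-Complex.I) • deriv x.1 t = y.1 t
    rw [(hd t).deriv]
    change (-Complex.I) • (Complex.I • y.1 t) = y.1 t
    rw [smul_smul, hI', one_smul]

/-- The operator `V ∈ End P_ω(ℝ, E)` of multiplication by `v ∈ P_ω(ℝ, End E)`:
`(V x)(t) = v(t) x(t)`. -/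
noncomputable def mulOp {ω : ℝ} {E : Type*} [NormedAddCommGroup E] [NormedSpace ℂ E]
    (v : periodicSpace ω (E →L[ℂ] E)) : periodicSpace ω E →L[ℂ] periodicSpace ω E :=
  LinearMap.mkContinuous
    { toFun := fun x =>
        ⟨BoundedContinuousFunction.ofNormedAddCommGroup (fun t => v.1 t (x.1 t))
            (v.1.continuous.clm_apply x.1.continuous) (‖v‖ * ‖x‖)
            (fun t => (v.1 t).le_of_opNorm_le_of_le (v.1.norm_coe_le_norm t)
              (x.1.norm_coe_le_norm t)),
          fun t => by
            change v.1 (t + ω) (x.1 (t + ω)) = v.1 t (x.1 t)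
            rw [v.2 t, x.2 t]⟩
      map_add' := fun x y =>
        Subtype.ext (BoundedContinuousFunction.ext fun t => (v.1 t).map_add (x.1 t) (y.1 t))
      map_smul' := fun c x =>
        Subtype.ext (BoundedContinuousFunction.ext fun t => (v.1 t).map_smul c (x.1 t)) }
    ‖v‖
    (fun x => BoundedContinuousFunction.norm_ofNormedAddCommGroup_le _
      (mul_nonneg (norm_nonneg v) (norm_nonneg x))
      (fun t => (v.1 t).le_of_opNorm_le_of_le (v.1.norm_coe_le_norm t) (x.1.norm_coe_le_norm t)))

theorem mulOp_apply {ω : ℝ} {E : Type*} [NormedAddCommGroup E] [NormedSpace ℂ E]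
    (v : periodicSpace ω (E →L[ℂ] E)) (x : periodicSpace ω E) (t : ℝ) :
    (mulOp v x).1 t = v.1 t (x.1 t) := rfl

/-- The constant function with value `c`, as an element of `P_ω(ℝ, E)`. -/
def constPeriodic (ω : ℝ) {E : Type*} [NormedAddCommGroup E] [NormedSpace ℂ E] (c : E) :
    periodicSpace ω E :=
  ⟨BoundedContinuousFunction.const ℝ c, fun _ => rfl⟩

/-- The operator `A - B` with domain `D(A)`, for an unbounded operator `A` and a bounded operator
`B`. -/
def subBounded {X : Type*} [NormedAddCommGroup X] [NormedSpace ℂ X]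
    (A : X →ₗ.[ℂ] X) (B : X →L[ℂ] X) : X →ₗ.[ℂ] X where
  domain := A.domain
  toFun := A.toFun - (B : X →ₗ[ℂ] X).comp A.domain.subtype

/-- `U` is a transformation operator of `A₁` into `A₂`: `U` is a continuously invertible bounded
operator with `U D(A₂) = D(A₁)` and `A₁ U x = U A₂ x` for `x ∈ D(A₂)`. The operators `A₁` and `A₂`
are similar if such a `U` exists. -/
structure Intertwines {X : Type*} [NormedAddCommGroup X] [NormedSpace ℂ X]
    (U : X ≃L[ℂ] X) (A₁ A₂ : X →ₗ.[ℂ] X) : Prop where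
  image_domain : ⇑U '' (A₂.domain : Set X) = A₁.domain
  apply_eq : ∀ (x : A₂.domain) (y : A₁.domain), (y : X) = U x → A₁ y = U (A₂ x)

/-!
The similarity is sought as multiplication by a periodic family `W` of operators: it carries `A - C`
to `A - V` exactly when `W' = i (v W - W C)`. Normalising the mean of `W` to be `1` forces `C` to be
the mean of `v W` and turns the equation into `W = 1 + i Γ (v W - W C)`, where `Γ` is the mean-zero
periodic antiderivative. Since `Γ` is `ω` times the convolution with a sawtooth of amplitude `1/2`
over the period, `‖Γ‖ ≤ ω / 4`, and the equation has a solution in the ball of radius one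
around `1` as soon as `‖Γ‖ ‖v‖ < 1 / 6`.
-/

section FixedPoint

variable {𝕜 𝒜 : Type*} [NontriviallyNormedField 𝕜] [NormedRing 𝒜] [NormedSpace 𝕜 𝒜]

/-- The residual `v W - W J(v W)` of the intertwining equation when the transformed perturbation is
taken to be the projection `J(v W)`. -/
def similarityResidual (J : 𝒜 →L[𝕜] 𝒜) (v W : 𝒜) : 𝒜 :=
  v * W - W * J (v * W)

theorem norm_similarityResidual_sub_le {J : 𝒜 →L[𝕜] 𝒜} (hJ : ‖J‖ ≤ 1) (v W W' : 𝒜) :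
    ‖similarityResidual J v W - similarityResidual J v W'‖ ≤
      ‖v‖ * (1 + ‖W‖ + ‖W'‖) * ‖W - W'‖ := by
  have norm_proj_le (x : 𝒜) : ‖J (v * x)‖ ≤ ‖v‖ * ‖x‖ :=
    (J.le_of_opNorm_le hJ _).trans (by simpa only [one_mul] using norm_mul_le v x)
  have expand : similarityResidual J v W - similarityResidual J v W' =
      v * (W - W') - (W - W') * J (v * W) - W' * J (v * (W - W')) := by
    simp only [similarityResidual, mul_sub, map_sub]
    noncomm_ring
  calc ‖similarityResidual J v W - similarityResidual J v W'‖
      ≤ ‖v * (W - W')‖ + ‖(W - W') * J (v * W)‖ + ‖W' * J (v * (W - W'))‖ := by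
        rw [expand]
        exact (norm_sub_le _ _).trans (by gcongr; exact norm_sub_le _ _)
    _ ≤ ‖v‖ * ‖W - W'‖ + ‖W - W'‖ * (‖v‖ * ‖W‖) + ‖W'‖ * (‖v‖ * ‖W - W'‖) := by
        gcongr
        · exact norm_mul_le _ _
        · exact (norm_mul_le _ _).trans (by gcongr; exact norm_proj_le W)
        · exact (norm_mul_le _ _).trans (by gcongr; exact norm_proj_le (W - W'))
    _ = ‖v‖ * (1 + ‖W‖ + ‖W'‖) * ‖W - W'‖ := by ring

theorem norm_similarityResidual_le {J : 𝒜 →L[𝕜] 𝒜} (hJ : ‖J‖ ≤ 1) (v W : 𝒜) :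
    ‖similarityResidual J v W‖ ≤ ‖v‖ * (1 + ‖W‖) * ‖W‖ := by
  simpa [similarityResidual] using norm_similarityResidual_sub_le hJ v W 0

theorem norm_map_similarityResidual_lt_one {J Γ : 𝒜 →L[𝕜] 𝒜} (hJ : ‖J‖ ≤ 1) {v W : 𝒜}
    (hv : ‖Γ‖ * ‖v‖ < 1 / 6) (hW : ‖W‖ ≤ 2) : ‖Γ (similarityResidual J v W)‖ < 1 :=
  calc ‖Γ (similarityResidual J v W)‖
      ≤ ‖Γ‖ * (‖v‖ * (1 + ‖W‖) * ‖W‖) := Γ.le_opNorm_of_le (norm_similarityResidual_le hJ v W)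
    _ ≤ ‖Γ‖ * (‖v‖ * (1 + 2) * 2) := by gcongr
    _ < 1 := by linarith

theorem norm_map_similarityResidual_sub_le {J Γ : 𝒜 →L[𝕜] 𝒜} (hJ : ‖J‖ ≤ 1) {v W W' : 𝒜}
    (hv : ‖Γ‖ * ‖v‖ < 1 / 6) (hW : ‖W‖ ≤ 2) (hW' : ‖W'‖ ≤ 2) :
    ‖Γ (similarityResidual J v W) - Γ (similarityResidual J v W')‖ ≤ 5 / 6 * ‖W - W'‖ := by
  rw [← map_sub]
  calc ‖Γ (similarityResidual J v W - similarityResidual J v W')‖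
      ≤ ‖Γ‖ * (‖v‖ * (1 + ‖W‖ + ‖W'‖) * ‖W - W'‖) :=
        Γ.le_opNorm_of_le (norm_similarityResidual_sub_le hJ v W W')
    _ ≤ ‖Γ‖ * (‖v‖ * (1 + 2 + 2) * ‖W - W'‖) := by gcongr
    _ = 5 * (‖Γ‖ * ‖v‖) * ‖W - W'‖ := by ring
    _ ≤ 5 / 6 * ‖W - W'‖ := by
        gcongr
        linarith

theorem exists_unit_eq_one_add_similarityResidual [CompleteSpace 𝒜] (h1 : ‖(1 : 𝒜)‖ ≤ 1)
    {J Γ : 𝒜 →L[𝕜] 𝒜} (hJ : ‖J‖ ≤ 1) {v : 𝒜} (hv : ‖Γ‖ * ‖v‖ < 1 / 6) :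
    ∃ W : 𝒜ˣ, (W : 𝒜) = 1 + Γ (similarityResidual J v W) := by
  let T (Y : 𝒜) : 𝒜 := Γ (similarityResidual J v (1 + Y))
  let ball : Set 𝒜 := Metric.closedBall 0 1
  have norm_one_add_le {Y : 𝒜} (hY : Y ∈ ball) : ‖1 + Y‖ ≤ 2 := by
    linarith [norm_add_le 1 Y, mem_closedBall_zero_iff.1 hY]
  have norm_T_lt {Y : 𝒜} (hY : Y ∈ ball) : ‖T Y‖ < 1 :=
    norm_map_similarityResidual_lt_one hJ hv (norm_one_add_le hY)
  have mapsTo_ball : Set.MapsTo T ball ball := fun Y hY =>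
    mem_closedBall_zero_iff.2 (norm_T_lt hY).le
  have lipschitz : LipschitzOnWith (5 / 6) T ball := .of_dist_le_mul fun Y hY Z hZ => by
    simpa [T, dist_eq_norm] using
      norm_map_similarityResidual_sub_le hJ hv (norm_one_add_le hY) (norm_one_add_le hZ)
  have contracting : ContractingWith (5 / 6) (mapsTo_ball.restrict T ball ball) :=
    ⟨by rw [div_lt_one (by norm_num)]; norm_num, lipschitz.mapsToRestrict mapsTo_ball⟩
  obtain ⟨Y, hY, fixed, -⟩ := contracting.exists_fixedPoint'
    Metric.isClosed_closedBall.isComplete mapsTo_ball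
    (Metric.mem_closedBall_self zero_le_one) (edist_ne_top 0 _)
  replace fixed : T Y = Y := fixed
  have norm_neg_lt : ‖-Y‖ < 1 := by
    rw [norm_neg, ← fixed]
    exact norm_T_lt hY
  refine ⟨Units.oneSub (-Y) norm_neg_lt, ?_⟩
  rw [Units.val_oneSub, sub_neg_eq_add]
  exact congrArg (1 + ·) fixed.symm

end FixedPoint

section Sawtooth

variable {F : Type*} [NormedAddCommGroup F] [NormedSpace ℝ F] {ω : ℝ} {f : ℝ → F}

/-- The mean value of `f` over `[0, ω]`, rescaled to the unit interval so that no division by `ω` is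
involved. -/
noncomputable def periodAverage (ω : ℝ) (f : ℝ → F) : F :=
  ∫ u in (0 : ℝ)..1, f (ω * u)

/-- The convolution of an `ω`-periodic function with the sawtooth kernel, again rescaled to the unit
interval. It is the mean-zero antiderivative of `f - periodAverage ω f`. -/
noncomputable def sawtoothIntegral (ω : ℝ) (f : ℝ → F) (t : ℝ) : F :=
  ω • ∫ u in (0 : ℝ)..1, (u - 1 / 2) • f (t + ω * u)

theorem norm_periodAverage_le {M : ℝ} (hM : ∀ t, ‖f t‖ ≤ M) : ‖periodAverage ω f‖ ≤ M := by
  simpa [periodAverage] using intervalIntegral.norm_integral_le_of_norm_le_const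
    (a := 0) (b := 1) fun u _ => hM (ω * u)

theorem integral_abs_sub_half : ∫ u in (0 : ℝ)..1, |u - 1 / 2| = 1 / 4 := by
  have left : ∫ u in (0 : ℝ)..1 / 2, |u - 1 / 2| = ∫ u in (0 : ℝ)..1 / 2, (1 / 2 - u) :=
    intervalIntegral.integral_congr fun u hu => by
      rw [Set.uIcc_of_le (by norm_num)] at hu
      rw [abs_of_nonpos (sub_nonpos.2 hu.2), neg_sub]
  have right : ∫ u in (1 / 2 : ℝ)..1, |u - 1 / 2| = ∫ u in (1 / 2 : ℝ)..1, (u - 1 / 2) :=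
    intervalIntegral.integral_congr fun u hu => by
      rw [Set.uIcc_of_le (by norm_num)] at hu
      exact abs_of_nonneg (sub_nonneg.2 hu.1)
  rw [← intervalIntegral.integral_add_adjacent_intervals (b := 1 / 2)
    (Continuous.intervalIntegrable (by fun_prop) _ _)
    (Continuous.intervalIntegrable (by fun_prop) _ _), left, right]
  norm_num [intervalIntegral.integral_comp_sub_left (fun u => u)]

theorem norm_sawtoothIntegral_le {M : ℝ} (hM : ∀ t, ‖f t‖ ≤ M) (t : ℝ) :
    ‖sawtoothIntegral ω f t‖ ≤ |ω| / 4 * M := by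
  have norm_integral_le : ‖∫ u in (0 : ℝ)..1, (u - 1 / 2) • f (t + ω * u)‖ ≤
      ∫ u in (0 : ℝ)..1, |u - 1 / 2| * M := by
    refine intervalIntegral.norm_integral_le_of_norm_le zero_le_one
      (Filter.Eventually.of_forall fun u _ => ?_) (Continuous.intervalIntegrable (by fun_prop) _ _)
    rw [norm_smul, Real.norm_eq_abs]
    gcongr
    exact hM _
  rw [intervalIntegral.integral_mul_const, integral_abs_sub_half] at norm_integral_le
  rw [sawtoothIntegral, norm_smul, Real.norm_eq_abs, div_mul_eq_mul_div, mul_div_assoc]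
  gcongr
  linarith

theorem continuous_sawtoothIntegral (hf : Continuous f) : Continuous (sawtoothIntegral ω f) :=
  (intervalIntegral.continuous_parametric_intervalIntegral_of_continuous'
    (by unfold Function.uncurry; fun_prop) _ _).const_smul ω

theorem sawtoothIntegral_add {g : ℝ → F} (hf : Continuous f) (hg : Continuous g) (t : ℝ) :
    sawtoothIntegral ω (f + g) t = sawtoothIntegral ω f t + sawtoothIntegral ω g t := by
  simp only [sawtoothIntegral, Pi.add_apply, smul_add (_ - _)]
  rw [intervalIntegral.integral_add (Continuous.intervalIntegrable (by fun_prop) _ _)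
    (Continuous.intervalIntegrable (by fun_prop) _ _), smul_add]

theorem sawtoothIntegral_const_smul {𝕜 : Type*} [NontriviallyNormedField 𝕜] [NormedSpace 𝕜 F]
    [SMulCommClass ℝ 𝕜 F] (c : 𝕜) (f : ℝ → F) (t : ℝ) :
    sawtoothIntegral ω (c • f) t = c • sawtoothIntegral ω f t := by
  simp only [sawtoothIntegral, Pi.smul_apply, smul_comm _ c, intervalIntegral.integral_smul]

theorem periodAverage_comp_const_add (hω : ω ≠ 0) (hp : Function.Periodic f ω) (t : ℝ) :
    periodAverage ω (fun s => f (t + s)) = periodAverage ω f := by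
  have periodic_one : Function.Periodic (fun u => f (ω * u)) 1 := fun u => by
    simp only [mul_add, mul_one, hp _]
  calc periodAverage ω (fun s => f (t + s)) = ∫ u in (0 : ℝ)..1, f (ω * (t / ω + u)) := by
        simp only [periodAverage, mul_add, mul_div_cancel₀ t hω]
    _ = ∫ u in (t / ω)..(t / ω + 1), f (ω * u) := by
        rw [intervalIntegral.integral_comp_add_left (fun u => f (ω * u)), add_zero]
    _ = periodAverage ω f := by
        rw [periodic_one.intervalIntegral_add_eq (t / ω) 0, zero_add, periodAverage]

theorem sawtoothIntegral_eq (hω : ω ≠ 0) (hf : Continuous f) (hp : Function.Periodic f ω)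
    (t : ℝ) :
    sawtoothIntegral ω f t =
      (∫ s in t..t + ω, (s / ω - 1 / 2) • f s) - t • periodAverage ω f := by
  have window : ∫ s in t..t + ω, (s / ω - 1 / 2) • f s =
      ω • ∫ u in (0 : ℝ)..1, ((u - 1 / 2) • f (t + ω * u) + (t / ω) • f (t + ω * u)) := by
    have subst := intervalIntegral.smul_integral_comp_add_mul (a := 0) (b := 1)
      (fun s => (s / ω - 1 / 2) • f s) ω t
    rw [mul_zero, add_zero, mul_one] at subst
    rw [← subst]
    congr 2 with u
    rw [← add_smul]
    congr 1
    field_simp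
    ring
  rw [window, intervalIntegral.integral_add (Continuous.intervalIntegrable (by fun_prop) _ _)
    (Continuous.intervalIntegrable (by fun_prop) _ _), smul_add, intervalIntegral.integral_smul,
    smul_smul, mul_div_cancel₀ t hω, ← periodAverage_comp_const_add hω hp t]
  exact (add_sub_cancel_right _ _).symm

theorem hasDerivAt_integral_add_const [CompleteSpace F] (hf : Continuous f) (a t : ℝ) :
    HasDerivAt (fun t => ∫ s in t..t + a, f s) (f (t + a) - f t) t := by
  have hasDerivAt_primitive (x : ℝ) : HasDerivAt (fun x => ∫ s in (0 : ℝ)..x, f s) (f x) x :=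
    intervalIntegral.integral_hasDerivAt_right (hf.intervalIntegrable _ _)
      (hf.stronglyMeasurableAtFilter _ _) hf.continuousAt
  have split : (fun t => ∫ s in t..t + a, f s) =
      fun t => (∫ s in (0 : ℝ)..t + a, f s) - ∫ s in (0 : ℝ)..t, f s := by
    funext t
    rw [intervalIntegral.integral_interval_sub_left (hf.intervalIntegrable _ _)
      (hf.intervalIntegrable _ _)]
  rw [split]
  exact ((hasDerivAt_primitive (t + a)).comp_add_const t a).sub (hasDerivAt_primitive t)

theorem hasDerivAt_sawtoothIntegral [CompleteSpace F] (hω : ω ≠ 0) (hf : Continuous f)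
    (hp : Function.Periodic f ω) (t : ℝ) :
    HasDerivAt (sawtoothIntegral ω f) (f t - periodAverage ω f) t := by
  have deriv_window := hasDerivAt_integral_add_const (f := fun s => (s / ω - 1 / 2) • f s)
    (by fun_prop) ω t
  have jump : ((t + ω) / ω - 1 / 2) • f (t + ω) - (t / ω - 1 / 2) • f t = f t := by
    rw [hp t, ← sub_smul, add_div, div_self hω]
    simp
  rw [jump] at deriv_window
  rw [funext (sawtoothIntegral_eq hω hf hp)]
  simpa using! deriv_window.sub ((hasDerivAt_id t).smul_const (periodAverage ω f))

theorem periodAverage_sawtoothIntegral [CompleteSpace F] (hω : ω ≠ 0) (hf : Continuous f)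
    (hp : Function.Periodic f ω) : periodAverage ω (sawtoothIntegral ω f) = 0 := by
  have integrable : MeasureTheory.IntegrableOn
      (Function.uncurry fun s u => (u - 1 / 2) • f (ω * s + ω * u))
      (Set.uIoc 0 1 ×ˢ Set.uIoc 0 1) (MeasureTheory.volume.prod MeasureTheory.volume) := by
    have continuous : Continuous (Function.uncurry fun s u => (u - 1 / 2) • f (ω * s + ω * u)) := by
      unfold Function.uncurry
      fun_prop
    exact (continuous.continuousOn.integrableOn_compact
      (isCompact_uIcc.prod isCompact_uIcc)).mono_set
      (Set.prod_mono Set.uIoc_subset_uIcc Set.uIoc_subset_uIcc)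
  have inner (u : ℝ) : ∫ s in (0 : ℝ)..1, (u - 1 / 2) • f (ω * s + ω * u) =
      (u - 1 / 2) • periodAverage ω f := by
    rw [intervalIntegral.integral_smul, ← periodAverage_comp_const_add hω hp (ω * u)]
    simp only [periodAverage, add_comm]
  have integral_kernel : ∫ u in (0 : ℝ)..1, (u - 1 / 2) = 0 := by
    norm_num [integral_id]
  simp only [periodAverage, sawtoothIntegral]
  rw [intervalIntegral.integral_smul,
    MeasureTheory.intervalIntegral_intervalIntegral_swap integrable]
  simp only [inner]
  rw [intervalIntegral.integral_smul_const, integral_kernel, zero_smul, smul_zero]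

end Sawtooth

section Intertwines

variable {X : Type*} [NormedAddCommGroup X] [NormedSpace ℂ X]

theorem mem_graph_subBounded {A : X →ₗ.[ℂ] X} {B : X →L[ℂ] X} {x f : X} :
    (x, f) ∈ (subBounded A B).graph ↔ (x, B x + f) ∈ A.graph := by
  simp only [LinearPMap.mem_graph_iff]
  constructor
  · rintro ⟨y, rfl, rfl⟩
    exact ⟨y, rfl, (add_sub_cancel (B y.1) (A y)).symm⟩
  · rintro ⟨y, rfl, hy⟩
    exact ⟨y, rfl, sub_eq_iff_eq_add'.2 hy⟩

theorem intertwines_of_mem_graph_iff {U : X ≃L[ℂ] X} {A₁ A₂ : X →ₗ.[ℂ] X}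
    (h : ∀ x y, (U x, U y) ∈ A₁.graph ↔ (x, y) ∈ A₂.graph) : Intertwines U A₁ A₂ where
  image_domain := by
    ext y
    simp only [Set.mem_image, SetLike.mem_coe, LinearPMap.mem_domain_iff]
    constructor
    · rintro ⟨x, ⟨z, hz⟩, rfl⟩
      exact ⟨U z, (h x z).2 hz⟩
    · rintro ⟨z, hz⟩
      refine ⟨U.symm y, ⟨U.symm z, (h _ _).1 ?_⟩, U.apply_symm_apply y⟩
      simpa only [U.apply_symm_apply] using hz
  apply_eq x y hy := A₁.mem_graph_snd_inj (A₁.mem_graph y) ((h x _).2 (A₂.mem_graph x)) hy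

end Intertwines

namespace periodicSpace

section Operators

variable {ω : ℝ} {E : Type*} [NormedAddCommGroup E] [NormedSpace ℂ E]

@[ext]
theorem ext {x y : periodicSpace ω E} (h : ∀ t, x.1 t = y.1 t) : x = y :=
  Subtype.ext (BoundedContinuousFunction.ext h)

instance [CompleteSpace E] : CompleteSpace (periodicSpace ω E) := by
  have closed : IsClosed (⋂ t, {x : ℝ →ᵇ E | x (t + ω) = x t}) :=
    isClosed_iInter fun t => isClosed_eq (continuous_eval_const (t + ω)) (continuous_eval_const t)
  rw [← Set.ofPred_forall] at closed
  exact closed.completeSpace_coe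

/-- The projection of a periodic function onto its mean, as a constant function. -/
noncomputable def meanProj (ω : ℝ) (E : Type*) [NormedAddCommGroup E] [NormedSpace ℂ E] :
    periodicSpace ω E →L[ℂ] periodicSpace ω E :=
  LinearMap.mkContinuous
    { toFun := fun f => constPeriodic ω (periodAverage ω f.1)
      map_add' := fun f g => ext fun _ => intervalIntegral.integral_add
        (Continuous.intervalIntegrable (by fun_prop) _ _)
        (Continuous.intervalIntegrable (by fun_prop) _ _)
      map_smul' := fun c f => ext fun _ =>
        intervalIntegral.integral_smul c fun u => f.1 (ω * u) }
    1
    fun f => by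
      rw [one_mul]
      exact (BoundedContinuousFunction.norm_const_le _).trans
        (norm_periodAverage_le f.1.norm_coe_le_norm)

theorem meanProj_apply (f : periodicSpace ω E) :
    meanProj ω E f = constPeriodic ω (periodAverage ω f.1) := rfl

theorem norm_meanProj_le : ‖meanProj ω E‖ ≤ 1 :=
  LinearMap.mkContinuous_norm_le _ zero_le_one _

theorem meanProj_constPeriodic [CompleteSpace E] (c : E) :
    meanProj ω E (constPeriodic ω c) = constPeriodic ω c := by
  rw [meanProj_apply]
  congr 1
  exact (intervalIntegral.integral_const c).trans (by simp)

/-- The operator inverting `d/dt` on periodic functions with mean zero; the mean of an arbitrary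
argument is discarded first, and among the antiderivatives the one with mean zero is chosen. -/
noncomputable def primitive (ω : ℝ) (E : Type*) [NormedAddCommGroup E] [NormedSpace ℂ E] :
    periodicSpace ω E →L[ℂ] periodicSpace ω E :=
  LinearMap.mkContinuous
    { toFun := fun f =>
        ⟨BoundedContinuousFunction.ofNormedAddCommGroup (sawtoothIntegral ω f.1)
            (continuous_sawtoothIntegral f.1.continuous) (|ω| / 4 * ‖f‖)
            (norm_sawtoothIntegral_le f.1.norm_coe_le_norm),
          fun t => by
            change sawtoothIntegral ω f.1 (t + ω) = sawtoothIntegral ω f.1 t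
            simp only [sawtoothIntegral, add_right_comm t ω, f.2 _]⟩
      map_add' := fun f g => ext fun t =>
        sawtoothIntegral_add f.1.continuous g.1.continuous t
      map_smul' := fun c f => ext fun t => sawtoothIntegral_const_smul c f.1 t }
    (|ω| / 4)
    fun f => BoundedContinuousFunction.norm_ofNormedAddCommGroup_le _ (by positivity)
      (norm_sawtoothIntegral_le f.1.norm_coe_le_norm)

theorem norm_primitive_le : ‖primitive ω E‖ ≤ |ω| / 4 :=
  LinearMap.mkContinuous_norm_le _ (by positivity) _

theorem hasDerivAt_primitive [CompleteSpace E] (hω : ω ≠ 0) (f : periodicSpace ω E) (t : ℝ) :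
    HasDerivAt (primitive ω E f).1 ((f - meanProj ω E f).1 t) t :=
  hasDerivAt_sawtoothIntegral hω f.1.continuous f.2 t

theorem meanProj_primitive [CompleteSpace E] (hω : ω ≠ 0) (f : periodicSpace ω E) :
    meanProj ω E (primitive ω E f) = 0 :=
  ext fun _ => periodAverage_sawtoothIntegral hω f.1.continuous f.2

end Operators

section Ring

variable {ω : ℝ} {R : Type*} [NormedRing R] [NormedAlgebra ℂ R]

/-- The periodic functions with values in a normed algebra, as an algebra under the pointwise
product; it only serves to equip `periodicSpace ω R` with that product. -/
noncomputable def toSubalgebra (ω : ℝ) (R : Type*) [NormedRing R] [NormedAlgebra ℂ R] :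
    Subalgebra ℂ (ℝ →ᵇ R) where
  __ := periodicSpace ω R
  mul_mem' hf hg t := congrArg₂ (· * ·) (hf t) (hg t)
  algebraMap_mem' _ _ := rfl

noncomputable scoped instance : NormedRing (periodicSpace ω R) where
  __ := (periodicSpace ω R).normedAddCommGroup
  __ := (toSubalgebra ω R).toRing
  dist_eq := NormedAddGroup.dist_eq
  norm_mul_le f g := norm_mul_le f.1 g.1

theorem norm_one_le (h1 : ‖(1 : R)‖ ≤ 1) : ‖(1 : periodicSpace ω R)‖ ≤ 1 :=
  (BoundedContinuousFunction.norm_const_le 1).trans h1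

theorem meanProj_mul_constPeriodic [CompleteSpace R] (f : periodicSpace ω R) (c : R) :
    meanProj ω R (f * constPeriodic ω c) = meanProj ω R f * constPeriodic ω c :=
  ext fun _ => ((ContinuousLinearMap.mul ℝ R).flip c).intervalIntegral_comp_comm
    (Continuous.intervalIntegrable (by fun_prop) 0 1)

/-- Evaluation at `t` as a homomorphism. -/
def evalHom (t : ℝ) : periodicSpace ω R →* R where
  toFun f := f.1 t
  map_one' := rfl
  map_mul' _ _ := rfl

theorem hasDerivAt_units_inv [CompleteSpace R] (W : (periodicSpace ω R)ˣ)
    {D : R} {t : ℝ} (hW : HasDerivAt W.1.1 D t) :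
    HasDerivAt (W⁻¹).1.1 (-(W⁻¹.1.1 t * D * W⁻¹.1.1 t)) t := by
  have inv_eq : ((W⁻¹).1.1 : ℝ → R) = Ring.inverse ∘ W.1.1 := funext fun s =>
    (Ring.inverse_unit (Units.map (evalHom s) W)).symm
  have deriv_inverse :
      HasDerivAt (Ring.inverse ∘ (W.1.1 : ℝ → R)) (-(W⁻¹.1.1 t * D * W⁻¹.1.1 t)) t :=
    (hasFDerivAt_ringInverse (𝕜 := ℝ) (Units.map (evalHom t) W)).comp_hasDerivAt t hW
  rwa [← inv_eq] at deriv_inverse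

/-- `IsGauge v w W` is the intertwining relation `(A - v) W = W (A - w)` for `A = -i d/dt`, written
as a differential equation for `W`. -/
def IsGauge (v w W : periodicSpace ω R) : Prop :=
  ∀ t, HasDerivAt W.1 ((Complex.I • (v * W - W * w)).1 t) t

theorem IsGauge.inv [CompleteSpace R] {v w : periodicSpace ω R} {W : (periodicSpace ω R)ˣ}
    (hW : IsGauge v w W) : IsGauge w v (W⁻¹ : (periodicSpace ω R)ˣ) := fun t => by
  have conj : -((W⁻¹ : (periodicSpace ω R)ˣ) * (v * W - W * w) * (W⁻¹ : (periodicSpace ω R)ˣ)) =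
      w * (W⁻¹ : (periodicSpace ω R)ˣ) - (W⁻¹ : (periodicSpace ω R)ˣ) * v := by
    simp [mul_sub, sub_mul, mul_assoc]
  refine (hasDerivAt_units_inv W (hW t)).congr_deriv ?_
  rw [← conj]
  change -(W⁻¹.1.1 t * (Complex.I • (v * W.1 - W.1 * w).1 t) * W⁻¹.1.1 t) =
    Complex.I • -(W⁻¹.1.1 t * (v * W.1 - W.1 * w).1 t * W⁻¹.1.1 t)
  simp only [mul_smul_comm, smul_mul_assoc, smul_neg]

theorem exists_isGauge_constPeriodic [CompleteSpace R] (h1 : ‖(1 : R)‖ ≤ 1) (hω : ω ≠ 0)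
    {v : periodicSpace ω R} (hv : |ω| * ‖v‖ < 2 / 3) :
    ∃ (C : R) (W : (periodicSpace ω R)ˣ), IsGauge v (constPeriodic ω C) W := by
  have small : ‖Complex.I • primitive ω R‖ * ‖v‖ < 1 / 6 := by
    calc ‖Complex.I • primitive ω R‖ * ‖v‖ ≤ ‖Complex.I‖ * ‖primitive ω R‖ * ‖v‖ := by
          gcongr
          exact ContinuousLinearMap.opNorm_smul_le _ _
      _ ≤ 1 * (|ω| / 4) * ‖v‖ := by
          gcongr
          exacts [Complex.norm_I.le, norm_primitive_le]
      _ < 1 / 6 := by linarith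
  obtain ⟨W, hW⟩ :=
    exists_unit_eq_one_add_similarityResidual (norm_one_le h1) norm_meanProj_le small
  let C : R := periodAverage ω (v * W.1).1
  set residual := similarityResidual (meanProj ω R) v W with residual_def
  have mean_W : meanProj ω R W = 1 := by
    rw [hW, map_add, smul_apply, map_smul, meanProj_primitive hω, smul_zero,
      add_zero]
    exact meanProj_constPeriodic 1
  have mean_residual : meanProj ω R residual = 0 := by
    rw [residual_def, similarityResidual, map_sub, meanProj_apply (v * W.1),
      meanProj_mul_constPeriodic, mean_W, one_mul, sub_self]
  refine ⟨C, W, fun t => ?_⟩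
  have deriv_W := ((hasDerivAt_primitive hω residual t).const_smul Complex.I).const_add 1
  rw [mean_residual, sub_zero] at deriv_W
  have W_eq : (W.1.1 : ℝ → R) = fun s => 1 + Complex.I • (primitive ω R residual).1 s :=
    congrArg (fun f : periodicSpace ω R => (f.1 : ℝ → R)) hW
  rw [W_eq]
  exact deriv_W

end Ring

section Similarity

variable {ω : ℝ} {E : Type*} [NormedAddCommGroup E] [NormedSpace ℂ E]

/-- `x` is a differentiable solution of `-i x' - v x = f`. -/
def IsSolution (v : periodicSpace ω (E →L[ℂ] E)) (x f : periodicSpace ω E) : Prop :=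
  ∀ t, HasDerivAt x.1 (Complex.I • (v.1 t (x.1 t) + f.1 t)) t

theorem mem_graph_diffOp {x y : periodicSpace ω E} :
    (x, y) ∈ (diffOp ω E).graph ↔ ∀ t, HasDerivAt x.1 (Complex.I • y.1 t) t := by
  rw [LinearPMap.mem_graph_iff]
  constructor
  · rintro ⟨⟨_, x', hx'⟩, rfl, rfl⟩ t
    rw [diffOp_apply, smul_smul, mul_neg, Complex.I_mul_I, neg_neg, one_smul, (hx' t).deriv]
    exact hx' t
  · intro hx
    refine ⟨⟨x, Complex.I • y, hx⟩, rfl, ext fun t => ?_⟩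
    rw [diffOp_apply, (hx t).deriv, smul_smul, neg_mul, Complex.I_mul_I, neg_neg, one_smul]

theorem mem_graph_subBounded_diffOp_mulOp {v : periodicSpace ω (E →L[ℂ] E)}
    {x f : periodicSpace ω E} :
    (x, f) ∈ (subBounded (diffOp ω E) (mulOp v)).graph ↔ IsSolution v x f :=
  mem_graph_subBounded.trans mem_graph_diffOp

theorem IsGauge.isSolution_mulOp {v w W : periodicSpace ω (E →L[ℂ] E)} (hW : IsGauge v w W)
    {u h : periodicSpace ω E} (hu : IsSolution w u h) :
    IsSolution v (mulOp W u) (mulOp W h) := fun t => by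
  have hW_real : HasDerivAt (fun s => (W.1 s).restrictScalars ℝ)
      (((Complex.I • (v * W - W * w)).1 t).restrictScalars ℝ) t :=
    (ContinuousLinearMap.restrictScalarsL ℂ E E ℝ ℝ).hasFDerivAt.comp_hasDerivAt t (hW t)
  refine (hW_real.clm_apply (hu t)).congr_deriv ?_
  change Complex.I • (v.1 t (W.1 t (u.1 t)) - W.1 t (w.1 t (u.1 t))) +
    W.1 t (Complex.I • (w.1 t (u.1 t) + h.1 t)) =
      Complex.I • (v.1 t (W.1 t (u.1 t)) + W.1 t (h.1 t))
  rw [map_smul, map_add, ← smul_add]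
  congr 1
  abel

/-- `mulOp` as a homomorphism, so that it turns invertible periodic families of operators into
invertible operators. -/
noncomputable def mulOpHom (ω : ℝ) (E : Type*) [NormedAddCommGroup E] [NormedSpace ℂ E] :
    periodicSpace ω (E →L[ℂ] E) →* (periodicSpace ω E →L[ℂ] periodicSpace ω E) where
  toFun := mulOp
  map_one' := rfl
  map_mul' _ _ := rfl

/-- The invertible operator of multiplication by an invertible periodic family of operators. -/
noncomputable def mulOpEquiv (W : (periodicSpace ω (E →L[ℂ] E))ˣ) :
    periodicSpace ω E ≃L[ℂ] periodicSpace ω E :=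
  ContinuousLinearEquiv.unitsEquiv ℂ _ (Units.map (mulOpHom ω E) W)

theorem IsGauge.isSolution_iff [CompleteSpace E] {v w : periodicSpace ω (E →L[ℂ] E)}
    {W : (periodicSpace ω (E →L[ℂ] E))ˣ} (hW : IsGauge v w W) {x f : periodicSpace ω E} :
    IsSolution v x f ↔ IsSolution w ((mulOpEquiv W).symm x) ((mulOpEquiv W).symm f) := by
  refine ⟨hW.inv.isSolution_mulOp, fun h => ?_⟩
  have := hW.isSolution_mulOp h
  rwa [← (mulOpEquiv W).apply_symm_apply x, ← (mulOpEquiv W).apply_symm_apply f]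

theorem IsGauge.intertwines [CompleteSpace E] {v w : periodicSpace ω (E →L[ℂ] E)}
    {W : (periodicSpace ω (E →L[ℂ] E))ˣ} (hW : IsGauge v w W) :
    Intertwines (mulOpEquiv W) (subBounded (diffOp ω E) (mulOp v))
      (subBounded (diffOp ω E) (mulOp w)) :=
  intertwines_of_mem_graph_iff fun x f => by
    simp only [mem_graph_subBounded_diffOp_mulOp, hW.isSolution_iff,
      ContinuousLinearEquiv.symm_apply_apply]

end Similarity

end periodicSpace

theorem abs_mul_lt_of_sqrt_three_mul_div_pi_lt {ω r : ℝ} (hω : 0 < ω) (hr : 0 ≤ r)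
    (h : 5.4 * Real.sqrt 3 * ω / Real.pi * r < 1) : |ω| * r < 2 / 3 := by
  have sqrt_three_ge : 1.7 ≤ Real.sqrt 3 := Real.le_sqrt_of_sq_le (by norm_num)
  have product_lt : 5.4 * Real.sqrt 3 * (ω * r) < Real.pi := by
    rw [div_mul_eq_mul_div, div_lt_one Real.pi_pos] at h
    linarith
  have := mul_le_mul_of_nonneg_right sqrt_three_ge (mul_nonneg hω.le hr)
  rw [abs_of_pos hω]
  linarith [Real.pi_lt_d2]

theorem mainTheorem8_general {E : Type*} [NormedAddCommGroup E] [NormedSpace ℂ E]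
    [CompleteSpace E] (ω : ℝ) (hω : ω ≠ 0) (v : periodicSpace ω (E →L[ℂ] E))
    (hv : |ω| * ‖v‖ < 2 / 3) :
    ∃ (C : E →L[ℂ] E) (U : periodicSpace ω E ≃L[ℂ] periodicSpace ω E),
      Intertwines U
        (subBounded (diffOp ω E) (mulOp v))
        (subBounded (diffOp ω E) (mulOp (constPeriodic ω C))) ∧
      ∀ x f : periodicSpace ω E,
        (∀ t, HasDerivAt x.1 (Complex.I • (v.1 t (x.1 t) + f.1 t)) t) ↔
          (∀ t, HasDerivAt (U.symm x).1
            (Complex.I • (C ((U.symm x).1 t) + (U.symm f).1 t)) t) := by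
  obtain ⟨C, W, hW⟩ := periodicSpace.exists_isGauge_constPeriodic
    ContinuousLinearMap.norm_id_le hω hv
  exact ⟨C, periodicSpace.mulOpEquiv W, hW.intertwines, fun _ _ => hW.isSolution_iff⟩

theorem mainTheorem8 {E : Type*} [NormedAddCommGroup E] [NormedSpace ℂ E] [CompleteSpace E]
    (ω : ℝ) (hω : 0 < ω) (v : periodicSpace ω (E →L[ℂ] E))
    (hv : 5.4 * Real.sqrt 3 * ω / Real.pi * ‖v‖ < 1) :
    ∃ (C : E →L[ℂ] E) (U : periodicSpace ω E ≃L[ℂ] periodicSpace ω E),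
      Intertwines U
        (subBounded (diffOp ω E) (mulOp v))
        (subBounded (diffOp ω E) (mulOp (constPeriodic ω C))) ∧
      ∀ x f : periodicSpace ω E,
        (∀ t, HasDerivAt x.1 (Complex.I • (v.1 t (x.1 t) + f.1 t)) t) ↔
          (∀ t, HasDerivAt (U.symm x).1
            (Complex.I • (C ((U.symm x).1 t) + (U.symm f).1 t)) t) :=
  mainTheorem8_general ω hω.ne' v (abs_mul_lt_of_sqrt_three_mul_div_pi_lt hω (norm_nonneg v) hv)
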